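/- For a scheme $X$ of finite type over $\mathbb{Z}$, write $[X]$ for the function $q\mapsto \#X(\mathbb{F}_q)$ on the set of all prime powers; $[X]\in\mathbb{Z}[q]$ means that there is a single polynomial $P\in\mathbb{Z}[q]$ with $\#X(\mathbb{F}_q)=P(q)$ for every prime power $q$. For a finite simple graph $G$ with vertex set $V=\{v_1,\dots,v_n\}$ and edge set $E$: - let $Q_G=\sum_T\prod_{e\in T}x_e\in\mathbb{Z}[x_e : e\in E]$, where $T$ runs over the spanning trees of $G$, and let $X_G=\mathbb{A}^E\setminus V(Q_G)$ be the complement in $\mathbb{A}^E_{\mathbb{Z}}$ of the hypersurface $Q_G=0$; - let $Z^o_G$ be the scheme over $\mathbb{Z}$ of nondegenerate (that is, of invertible determinant) symmetric $n\times n$ matrices $M$ such that $M_{ij}=0$ whenever $i\neq j$ and there is no edge between $v_i$ and $v_j$ in $G$. Let $F$ be a forest (a graph without cycles) with $r$ vertices that is a subgraph of the complete graph $K_s$ on $s$ vertices, and let $G=K_s-F$ be the graph obtained from $K_s$ by removing the edges of $F$ and keeping all $s$ vertices. Then 1. $[Z^o_G]\in\mathbb{Z}[q]$; 2. if $s>r$,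 then $[X_G]\in\mathbb{Z}[q]$. -/

import Mathlib

open CategoryTheory AlgebraicGeometry

noncomputable section

/-- `X` is polynomially countable: there is a single polynomial `P` over `ℤ` such that, for every
finite field `F` with `q` elements (of any characteristic), the set `X(F)` of morphisms
`Spec F ⟶ X` is finite with exactly `P(q)` elements. -/
def PolynomiallyCountable (X : Scheme.{0}) : Prop :=
  ∃ P : Polynomial ℤ, ∀ (F : Type) [Field F] [Finite F],
    Finite (Spec (CommRingCat.of F) ⟶ X) ∧
      (Nat.card (Spec (CommRingCat.of F) ⟶ X) : ℤ) = P.eval (Nat.card F : ℤ)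

open Classical in
/-- `Q_G`, the sum over the spanning trees `T` of `G` of the product of the variables `x_e`
over the edges `e` of `T`. A spanning tree is a tree on the whole vertex set `V` all of whose
edges are edges of `G`. -/
def stanleyPolynomial {V : Type} [Fintype V] (G : SimpleGraph V) : MvPolynomial G.edgeSet ℤ :=
  ∑ T : SimpleGraph V with T ≤ G ∧ T.IsTree,
    ∏ e ∈ Finset.univ.filter (fun e : G.edgeSet => (e : Sym2 V) ∈ T.edgeSet), MvPolynomial.X e

/-- `X_G`, the complement of the hypersurface `Q_G = 0` in the affine space `𝔸^E` over `ℤ`: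
the spectrum of `ℤ[x_e : e ∈ E]` with `Q_G` inverted. -/
def stanleyScheme {V : Type} [Fintype V] (G : SimpleGraph V) : Scheme.{0} :=
  Spec (CommRingCat.of (Localization.Away (stanleyPolynomial G)))

/-- The ideal of `ℤ[y_ij : i, j ∈ V]` generated by all `y_ij - y_ji`, and by all `y_ij` with
`i ≠ j` and `i`, `j` not adjacent in `G`. -/
def symmetricSupportIdeal {V : Type} (G : SimpleGraph V) : Ideal (MvPolynomial (V × V) ℤ) :=
  Ideal.span
    ({p | ∃ i j : V, p = MvPolynomial.X (i, j) - MvPolynomial.X (j, i)} ∪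
      {p | ∃ i j : V, i ≠ j ∧ ¬ G.Adj i j ∧ p = MvPolynomial.X (i, j)})

/-- The generic symmetric matrix whose off-diagonal entries vanish at the non-edges of `G`. -/
def genericSymmetricMatrix {V : Type} (G : SimpleGraph V) :
    Matrix V V (MvPolynomial (V × V) ℤ ⧸ symmetricSupportIdeal G) :=
  Matrix.of fun i j => Ideal.Quotient.mk (symmetricSupportIdeal G) (MvPolynomial.X (i, j))

/-- `Z^o_G`, the scheme over `ℤ` of nondegenerate symmetric `V × V` matrices `M` such that
`M i j = 0` whenever `i ≠ j` and `i`, `j` are not adjacent in `G`. -/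
def nondegSymmetricScheme {V : Type} [Fintype V] [DecidableEq V] (G : SimpleGraph V) :
    Scheme.{0} :=
  Spec (CommRingCat.of (Localization.Away (genericSymmetricMatrix G).det))

end

/-! Over a field with `q` elements, the points of `Z^o_G` are the symmetric matrices of full rank
vanishing on the edges of the complement of `G`, which is `F` plus isolated vertices. The induction
needs all ranks at once: for every forest `H` and every `ρ`, the symmetric matrices of rank `ρ`
vanishing on the edges of `H` are counted by a polynomial in `q`
(`SimpleGraph.IsAcyclic.exists_polynomial_symmRankCount`).

A forest has a vertex `v` with at most one neighbour; delete its row and column. Bordering `M` by a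
vector `x` and a corner `c` raises the rank by 0 or 1 if `x` lies in the column space of `M` (by 0
for exactly one `c`), and by 2 otherwise. So only the rank of `M` and the number of allowed `x` in
its column space matter. If `v` is isolated, that number is `q ^ rank`. If `v` has the neighbour
`u`, allowed means `x u = 0`, and the number is `q ^ rank` or `q ^ (rank - 1)` according to whether
row `u` of `M` vanishes. Matrices with row `u` zero are counted by the forest with `u` deleted as
well. The argument is independent of the characteristic.

For `X_G`, the matrix-tree theorem makes `Q_G` the determinant of a reduced Laplacian. If `F` misses
a vertex, that vertex is adjacent to all others in `G`; with it as root, edge weights correspond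
bijectively to symmetric matrices on the other vertices: weights away from the root are off-diagonal
entries up to sign, weights at the root are row sums. This is again a count of full-rank matrices
avoiding a forest. -/

/-- The symmetric matrix obtained from `M` by adding a row and a column `x` and a diagonal
entry `c`. -/
def Matrix.border {W K : Type*} (M : Matrix W W K) (x : W → K) (c : K) :
    Matrix (Option W) (Option W) K :=
  Matrix.of fun i j => i.elim (j.elim c x) fun i' => j.elim (x i') (M i')

/-! ### Bordered symmetric matrices -/

section Border

variable {W K : Type*} (M : Matrix W W K) (x : W → K) (c : K)

@[simp] theorem Matrix.border_none_none : M.border x c none none = c := rfl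
@[simp] theorem Matrix.border_none_some (j : W) : M.border x c none (some j) = x j := rfl
@[simp] theorem Matrix.border_some_none (i : W) : M.border x c (some i) none = x i := rfl
@[simp] theorem Matrix.border_some_some (i j : W) : M.border x c (some i) (some j) = M i j := rfl

theorem Matrix.border_isSymm_iff : (M.border x c).IsSymm ↔ M.IsSymm := by
  constructor
  · intro h
    ext i j
    exact congrFun (congrFun h (some i)) (some j)
  · intro h
    ext i j
    rcases i with _ | i <;> rcases j with _ | j <;> simp
    exact h.apply i j

theorem Matrix.border_of_isSymm {N : Matrix (Option W) (Option W) K} (h : N.IsSymm) :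
    (N.submatrix some some).border (fun i => N none (some i)) (N none none) = N := by
  ext i j
  rcases i with _ | i <;> rcases j with _ | j <;> simp
  exact h.apply _ _

end Border

/-! ### Rank of a bordered matrix -/

section BorderRank

variable {W K : Type*} [Fintype W] [Field K] (M : Matrix W W K) (x : W → K) (c : K)

theorem Matrix.border_mulVec_none (v : Option W → K) :
    (M.border x c).mulVec v none = c * v none + x ⬝ᵥ (v ∘ some) := by
  simp [Matrix.mulVec, dotProduct, Fintype.sum_option]

theorem Matrix.border_mulVec_some (v : Option W → K) (i : W) :
    (M.border x c).mulVec v (some i) = x i * v none + M.mulVec (v ∘ some) i := by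
  simp [Matrix.mulVec, dotProduct, Fintype.sum_option]

theorem Matrix.border_mulVec_eq_zero_iff (v : Option W → K) :
    (M.border x c).mulVec v = 0 ↔
      c * v none + x ⬝ᵥ (v ∘ some) = 0 ∧ v none • x + M.mulVec (v ∘ some) = 0 := by
  rw [funext_iff, Option.forall, Matrix.border_mulVec_none, funext_iff]
  simp [Matrix.border_mulVec_some, mul_comm]

theorem finrank_range_of_ne_zero {V : Type*} [AddCommGroup V] [Module K V] {f : V →ₗ[K] K}
    {v : V} (h : f v ≠ 0) : Module.finrank K (LinearMap.range f) = 1 := by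
  rw [LinearMap.range_eq_top.mpr (LinearMap.surjective fun h0 => h (by simp [h0]))]
  simp

theorem Matrix.rank_add_finrank_ker {V : Type*} [Fintype V] (N : Matrix V V K) :
    N.rank + Module.finrank K (LinearMap.ker N.mulVecLin) = Fintype.card V := by
  rw [Matrix.rank, LinearMap.finrank_range_add_finrank_ker, Module.finrank_fintype_fun_eq_card]

/-- The last coordinate on the kernel of a bordered matrix. -/
def Matrix.borderKerLast : LinearMap.ker (M.border x c).mulVecLin →ₗ[K] K :=
  (LinearMap.proj none).comp (Submodule.subtype _)

/-- The pairing with `x` on the kernel of `M`. -/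
def Matrix.kerPairing : LinearMap.ker M.mulVecLin →ₗ[K] K where
  toFun z := x ⬝ᵥ z.1
  map_add' := by simp
  map_smul' := by simp

/-- The kernel vectors of a bordered matrix with last coordinate zero are the kernel vectors of
the matrix that are orthogonal to the border. -/
def Matrix.kerBorderKerLastEquiv :
    LinearMap.ker (M.borderKerLast x c) ≃ₗ[K] LinearMap.ker (M.kerPairing x) where
  toFun v := ⟨⟨v.1.1 ∘ some, by
      have h1 := v.1.2
      have h2 : v.1.1 none = 0 := v.2
      rw [LinearMap.mem_ker, Matrix.mulVecLin_apply, Matrix.border_mulVec_eq_zero_iff, h2] at h1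
      simpa using h1.2⟩, by
      have h1 := v.1.2
      have h2 : v.1.1 none = 0 := v.2
      rw [LinearMap.mem_ker, Matrix.mulVecLin_apply, Matrix.border_mulVec_eq_zero_iff, h2] at h1
      simpa [Matrix.kerPairing] using h1.1⟩
  map_add' _ _ := rfl
  map_smul' _ _ := rfl
  invFun z := ⟨⟨fun o => o.elim 0 z.1.1, by
      have h1 : M.mulVec z.1.1 = 0 := z.1.2
      have h2 : x ⬝ᵥ z.1.1 = 0 := z.2
      rw [LinearMap.mem_ker, Matrix.mulVecLin_apply, Matrix.border_mulVec_eq_zero_iff]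
      refine ⟨?_, ?_⟩
      · simpa [Function.comp_def] using h2
      · simpa [Function.comp_def] using h1⟩, rfl⟩
  left_inv v := by
    have h2 : v.1.1 none = 0 := v.2
    ext o
    rcases o with _ | o
    · exact h2.symm
    · rfl
  right_inv _ := rfl

/-- Rank-nullity for both matrices, whose kernels share a subspace up to isomorphism
(`Matrix.kerBorderKerLastEquiv`). Each range lies in `K`, so has dimension 0 or 1; the three rank
jumps come from deciding which. -/
theorem Matrix.rank_border_add :
    (M.border x c).rank + Module.finrank K (LinearMap.range (M.borderKerLast x c)) =
      M.rank + Module.finrank K (LinearMap.range (M.kerPairing x)) + 1 := by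
  have h1 := Matrix.rank_add_finrank_ker (M.border x c)
  have h2 := Matrix.rank_add_finrank_ker M
  have h3 := LinearMap.finrank_range_add_finrank_ker (M.borderKerLast x c)
  have h4 := LinearMap.finrank_range_add_finrank_ker (M.kerPairing x)
  have h5 := (M.kerBorderKerLastEquiv x c).finrank_eq
  rw [Fintype.card_option] at h1
  omega

variable {M}

/-- For symmetric `M` the column space is orthogonal to the kernel. -/
theorem Matrix.kerPairing_mulVec_eq_zero (hM : M.IsSymm) (y : W → K) :
    M.kerPairing (M.mulVec y) = 0 := by
  ext z
  have h : M.mulVec z.1 = 0 := z.2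
  change M.mulVec y ⬝ᵥ z.1 = 0
  rw [dotProduct_comm, Matrix.dotProduct_mulVec, ← Matrix.mulVec_transpose, hM.eq, h,
    zero_dotProduct]

/-- Adjoining a combination of the columns with the matching diagonal entry keeps the rank. -/
theorem Matrix.rank_border_mulVec (hM : M.IsSymm) (y : W → K) :
    (M.border (M.mulVec y) (y ⬝ᵥ M.mulVec y)).rank = M.rank := by
  have h := M.rank_border_add (M.mulVec y) (y ⬝ᵥ M.mulVec y)
  rw [Matrix.kerPairing_mulVec_eq_zero hM, LinearMap.range_zero, finrank_bot] at h
  -- The column relation itself gives a kernel vector, `y` with last coordinate `-1`, so the last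
  -- coordinate is a nonzero functional on the kernel.
  have hv : (M.border (M.mulVec y) (y ⬝ᵥ M.mulVec y)).mulVec (fun o => o.elim (-1) y) = 0 := by
    rw [Matrix.border_mulVec_eq_zero_iff]
    simp [Function.comp_def, dotProduct_comm]
  rw [finrank_range_of_ne_zero (f := M.borderKerLast (M.mulVec y) (y ⬝ᵥ M.mulVec y))
    (v := ⟨_, hv⟩) (by simp [Matrix.borderKerLast])] at h
  omega

/-- Adjoining a combination of the columns with another diagonal entry raises the rank by one. -/
theorem Matrix.rank_border_mulVec_of_ne (hM : M.IsSymm) (y : W → K)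
    (hc : c ≠ y ⬝ᵥ M.mulVec y) :
    (M.border (M.mulVec y) c).rank = M.rank + 1 := by
  have h := M.rank_border_add (M.mulVec y) c
  rw [Matrix.kerPairing_mulVec_eq_zero hM, LinearMap.range_zero, finrank_bot] at h
  have h0 : M.borderKerLast (M.mulVec y) c = 0 := by
    ext ⟨v, hv⟩
    rw [LinearMap.mem_ker, Matrix.mulVecLin_apply, Matrix.border_mulVec_eq_zero_iff] at hv
    obtain ⟨h1, h2⟩ := hv
    change v none = 0
    have h3 : M.mulVec y ⬝ᵥ (v ∘ some) = y ⬝ᵥ M.mulVec (v ∘ some) := by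
      rw [Matrix.dotProduct_mulVec, ← Matrix.mulVec_transpose, hM.eq]
    -- Pairing the second kernel equation with `y` and subtracting it from the first leaves only the
    -- last coordinate, times `c - y ⬝ᵥ M.mulVec y`.
    have h4 := congrArg (y ⬝ᵥ ·) h2
    simp only [dotProduct_add, dotProduct_smul, smul_eq_mul, dotProduct_zero] at h4
    have h5 : (c - y ⬝ᵥ M.mulVec y) * v none = 0 := by
      rw [h3] at h1
      linear_combination h1 - h4
    exact (mul_eq_zero.mp h5).resolve_left (sub_ne_zero.mpr hc)
  rw [h0, LinearMap.range_zero, finrank_bot] at h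
  omega

/-- Adjoining a vector outside the column space raises the rank by two. -/
theorem Matrix.rank_border_of_notMem (hM : M.IsSymm) (hx : x ∉ LinearMap.range M.mulVecLin) :
    (M.border x c).rank = M.rank + 2 := by
  classical
  have h := M.rank_border_add x c
  have h0 : M.borderKerLast x c = 0 := by
    ext ⟨v, hv⟩
    rw [LinearMap.mem_ker, Matrix.mulVecLin_apply, Matrix.border_mulVec_eq_zero_iff] at hv
    obtain ⟨-, h2⟩ := hv
    change v none = 0
    by_contra hne
    refine hx ⟨-((v none)⁻¹ • (v ∘ some)), ?_⟩
    rw [Matrix.mulVecLin_apply, Matrix.mulVec_neg, Matrix.mulVec_smul,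
      eq_neg_of_add_eq_zero_right h2, smul_neg, neg_neg, smul_smul, inv_mul_cancel₀ hne, one_smul]
  rw [h0, LinearMap.range_zero, finrank_bot] at h
  -- A functional vanishing on the column space but not at `x` is pairing with some `z`; symmetry of
  -- `M` puts `z` in the kernel, so pairing with `x` is nonzero there.
  obtain ⟨f, hf1, hf2⟩ := Submodule.exists_le_ker_of_notMem hx
  obtain ⟨z, hz⟩ : ∃ z : W → K, ∀ w, f w = z ⬝ᵥ w := by
    refine ⟨fun i => f (Pi.single i 1), fun w => ?_⟩
    conv_lhs => rw [pi_eq_sum_univ' w]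
    simp [dotProduct, mul_comm]
  have hMz : M.mulVec z = 0 := by
    ext i
    have h6 : f (M.mulVec (Pi.single i 1)) = 0 := hf2 ⟨_, rfl⟩
    rw [hz, Matrix.dotProduct_mulVec, ← Matrix.mulVec_transpose, hM.eq] at h6
    simpa using h6
  rw [finrank_range_of_ne_zero (f := M.kerPairing x) (v := ⟨z, hMz⟩)
    (by rw [hz] at hf1; simpa [Matrix.kerPairing, dotProduct_comm] using hf1)] at h
  omega

end BorderRank

/-! ### Counting borders of a fixed matrix -/

/-- `M` is symmetric and vanishes at the edges of `H`. -/
def SimpleGraph.SymmAvoids {V K : Type*} [Zero K] (H : SimpleGraph V) (M : Matrix V V K) : Prop :=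
  M.IsSymm ∧ ∀ i j, H.Adj i j → M i j = 0

/-- The number of symmetric matrices of rank `ρ` over `K` that vanish at the edges of `H`. -/
noncomputable def SimpleGraph.symmRankCount {V : Type} [Fintype V] (H : SimpleGraph V)
    (K : Type) [Field K] (ρ : ℕ) : ℕ :=
  Nat.card {M : Matrix V V K // H.SymmAvoids M ∧ M.rank = ρ}

theorem SimpleGraph.symmRankCount_comap {V W : Type} [Fintype V] [Fintype W] (H : SimpleGraph V)
    (e : W ≃ V) (K : Type) [Field K] (ρ : ℕ) :
    (H.comap e).symmRankCount K ρ = H.symmRankCount K ρ := by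
  refine Nat.card_congr ((Matrix.reindex e e).subtypeEquiv fun M => ?_)
  rw [Matrix.rank_reindex, SimpleGraph.SymmAvoids, SimpleGraph.SymmAvoids]
  refine and_congr_left fun _ => and_congr ?_ ?_
  · constructor
    · intro h
      exact h.submatrix e.symm
    · intro h
      simpa using h.submatrix e
  · constructor
    · intro h i j hij
      exact h _ _ (by simpa using hij)
    · intro h i j hij
      simpa using h (e i) (e j) hij

section Fiber

variable {W K : Type*} [Fintype W] [Field K]

/-- One corner entry keeps the rank; the other `q - 1` raise it by one. -/
theorem Matrix.card_border_rank_of_mem [Finite K] {M : Matrix W W K} (hM : M.IsSymm) {x : W → K}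
    (hx : x ∈ LinearMap.range M.mulVecLin) (ρ : ℕ) :
    (Nat.card {c : K // (M.border x c).rank = ρ} : ℤ) =
      (if M.rank = ρ then 1 else 0) + if M.rank + 1 = ρ then (Nat.card K : ℤ) - 1 else 0 := by
  classical
  obtain ⟨y, rfl⟩ := hx
  rw [Matrix.mulVecLin_apply]
  have key : ∀ c, (M.border (M.mulVec y) c).rank =
      if c = y ⬝ᵥ M.mulVec y then M.rank else M.rank + 1 := by
    intro c
    split_ifs with h
    · rw [h, Matrix.rank_border_mulVec hM]
    · exact Matrix.rank_border_mulVec_of_ne c hM y h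
  simp only [key]
  have := Fintype.ofFinite K
  by_cases h1 : M.rank = ρ
  · have : ∀ c, (if c = y ⬝ᵥ M.mulVec y then M.rank else M.rank + 1) = ρ ↔
        c = y ⬝ᵥ M.mulVec y := by
      intro c; split_ifs with h <;> simp [h] <;> omega
    simp only [this]
    simp [h1]
  · by_cases h2 : M.rank + 1 = ρ
    · have : ∀ c, (if c = y ⬝ᵥ M.mulVec y then M.rank else M.rank + 1) = ρ ↔
          ¬ c = y ⬝ᵥ M.mulVec y := by
        intro c; split_ifs with h <;> simp [h] <;> omega
      simp only [this]
      rw [Nat.card_eq_fintype_card, Fintype.card_subtype_compl, Nat.card_eq_fintype_card]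
      rw [Nat.cast_sub (Fintype.card_subtype_le _)]
      simp [h1, h2]
    · have : ∀ c, ¬ (if c = y ⬝ᵥ M.mulVec y then M.rank else M.rank + 1) = ρ := by
        intro c; split_ifs with h <;> omega
      simp [this, h1, h2]

theorem Matrix.card_border_rank_of_notMem {M : Matrix W W K} (hM : M.IsSymm) {x : W → K}
    (hx : x ∉ LinearMap.range M.mulVecLin) (ρ : ℕ) :
    (Nat.card {c : K // (M.border x c).rank = ρ} : ℤ) =
      if M.rank + 2 = ρ then (Nat.card K : ℤ) else 0 := by
  simp only [Matrix.rank_border_of_notMem x _ hM hx]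
  split_ifs with h <;> simp [h]

/-- The number of borders in `U` that extend `M` to a matrix of rank `ρ`. -/
theorem Matrix.card_border_rank [Finite K] {M : Matrix W W K} (hM : M.IsSymm) (U : Submodule K (W → K))
    (ρ : ℕ) :
    (Nat.card {p : (W → K) × K // p.1 ∈ U ∧ (M.border p.1 p.2).rank = ρ} : ℤ) =
      (if M.rank = ρ then (Nat.card ↥(U ⊓ LinearMap.range M.mulVecLin) : ℤ) else 0) +
      (if M.rank + 1 = ρ then
        (Nat.card ↥(U ⊓ LinearMap.range M.mulVecLin) : ℤ) * ((Nat.card K : ℤ) - 1) else 0) +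
      (if M.rank + 2 = ρ then
        (Nat.card K : ℤ) * ((Nat.card U : ℤ) - Nat.card ↥(U ⊓ LinearMap.range M.mulVecLin))
        else 0) := by
  classical
  have e : {p : (W → K) × K // p.1 ∈ U ∧ (M.border p.1 p.2).rank = ρ} ≃
      Σ x : U, {c : K // (M.border x.1 c).rank = ρ} :=
    { toFun := fun p => ⟨⟨p.1.1, p.2.1⟩, ⟨p.1.2, p.2.2⟩⟩
      invFun := fun s => ⟨(s.1.1, s.2.1), s.1.2, s.2.2⟩
      left_inv := fun _ => rfl
      right_inv := fun _ => rfl }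
  have := Fintype.ofFinite U
  rw [Nat.card_congr e, Nat.card_sigma, Nat.cast_sum]
  have key : ∀ x : U, (Nat.card {c : K // (M.border x.1 c).rank = ρ} : ℤ) =
      if x.1 ∈ LinearMap.range M.mulVecLin then
        (if M.rank = ρ then 1 else 0) + (if M.rank + 1 = ρ then (Nat.card K : ℤ) - 1 else 0)
      else (if M.rank + 2 = ρ then (Nat.card K : ℤ) else 0) := by
    intro x
    by_cases hx : x.1 ∈ LinearMap.range M.mulVecLin
    · rw [if_pos hx, Matrix.card_border_rank_of_mem hM hx]
    · rw [if_neg hx, Matrix.card_border_rank_of_notMem hM hx]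
  have hcard : (Finset.univ.filter fun x : U => x.1 ∈ LinearMap.range M.mulVecLin).card =
      Nat.card ↥(U ⊓ LinearMap.range M.mulVecLin) := by
    rw [← Fintype.card_subtype, ← Nat.card_eq_fintype_card]
    exact Nat.card_congr
      { toFun := fun x => ⟨x.1.1, x.1.2, x.2⟩
        invFun := fun x => ⟨⟨x.1, x.2.1⟩, x.2.2⟩
        left_inv := fun _ => rfl
        right_inv := fun _ => rfl }
  have hcard' := Finset.card_filter_add_card_filter_not (s := (Finset.univ : Finset U))
    fun x : U => x.1 ∈ LinearMap.range M.mulVecLin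
  rw [hcard, Finset.card_univ, ← Nat.card_eq_fintype_card] at hcard'
  rw [Finset.sum_congr rfl fun x _ => key x, Finset.sum_ite, Finset.sum_const, Finset.sum_const,
    hcard, ← hcard']
  simp only [nsmul_eq_mul]
  push_cast
  split_ifs <;> ring

end Fiber

/-! ### Recursion for adding one vertex -/

section Step

open Polynomial

/-- The vectors allowed as borders: zero at the neighbours of `none`. -/
def SimpleGraph.borderSpace {W : Type} (H : SimpleGraph (Option W)) (K : Type) [Field K] :
    Submodule K (W → K) where
  carrier := {x | ∀ i, H.Adj none (some i) → x i = 0}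
  add_mem' ha hb i hi := by simp [ha i hi, hb i hi]
  zero_mem' _ _ := rfl
  smul_mem' c x hx i hi := by simp [hx i hi]

theorem SimpleGraph.symmAvoids_border_iff {W K : Type} [Field K] (H : SimpleGraph (Option W))
    (M : Matrix W W K) (x : W → K) (c : K) :
    H.SymmAvoids (M.border x c) ↔ (H.comap some).SymmAvoids M ∧ x ∈ H.borderSpace K := by
  rw [SimpleGraph.SymmAvoids, SimpleGraph.SymmAvoids, Matrix.border_isSymm_iff, and_assoc]
  refine and_congr_right fun _ => ?_
  constructor
  · intro h
    exact ⟨fun i j hij => h (some i) (some j) hij, fun i hi => h none (some i) hi⟩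
  · rintro ⟨h1, h2⟩ i j hij
    rcases i with _ | i <;> rcases j with _ | j
    · exact absurd hij (H.loopless.irrefl _)
    · exact h2 j hij
    · exact h2 i hij.symm
    · exact h1 i j hij

/-- A symmetric matrix on `Option W` that avoids `H` amounts to such a matrix on `W` and a
border. -/
def SimpleGraph.symmAvoidsEquiv {W : Type} [Fintype W] (H : SimpleGraph (Option W)) (K : Type)
    [Field K] (ρ : ℕ) :
    {N : Matrix (Option W) (Option W) K // H.SymmAvoids N ∧ N.rank = ρ} ≃
      Σ M : {M : Matrix W W K // (H.comap some).SymmAvoids M},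
        {p : (W → K) × K // p.1 ∈ H.borderSpace K ∧ (M.1.border p.1 p.2).rank = ρ} where
  toFun N :=
    have hb := Matrix.border_of_isSymm N.2.1.1
    have h := (H.symmAvoids_border_iff _ _ _).mp (by rw [hb]; exact N.2.1)
    ⟨⟨N.1.submatrix some some, h.1⟩, ⟨(fun i => N.1 none (some i), N.1 none none), h.2, by
      rw [hb]; exact N.2.2⟩⟩
  invFun s := ⟨s.1.1.border s.2.1.1 s.2.1.2,
    (H.symmAvoids_border_iff _ _ _).mpr ⟨s.1.2, s.2.2.1⟩, s.2.2.2⟩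
  left_inv N := Subtype.ext (Matrix.border_of_isSymm N.2.1.1)
  right_inv _ := rfl

/-- The number of extensions to rank `ρ` of a matrix of rank `σ`, as a polynomial in the size of
the field, if `X ^ e` borders are allowed and `a` of these lie in the column space. -/
noncomputable def borderPolynomial (ρ σ e : ℕ) (a : ℤ[X]) : ℤ[X] :=
  (if σ = ρ then a else 0) + (if σ + 1 = ρ then a * (X - 1) else 0) +
    (if σ + 2 = ρ then X * (X ^ e - a) else 0)

-- The inductive step, common to an isolated vertex and a leaf. `Z` singles out the matrices whose
-- column space meets the border space in `q ^ rank` vectors; the others lose one dimension.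
-- Counting by rank and by `Z` makes the total a finite sum of products of polynomials.
open Classical in
theorem SimpleGraph.exists_polynomial_symmRankCount_option {W : Type} [Fintype W]
    (H : SimpleGraph (Option W)) (e : ℕ) (Z : ∀ (K : Type) [Field K], Matrix W W K → Prop)
    (hU : ∀ (K : Type) [Field K] [Finite K], Nat.card (H.borderSpace K) = Nat.card K ^ e)
    (ha : ∀ (K : Type) [Field K] [Finite K] (M : Matrix W W K), (H.comap some).SymmAvoids M →
      Nat.card ↥(H.borderSpace K ⊓ LinearMap.range M.mulVecLin) =
        Nat.card K ^ (if Z K M then M.rank else M.rank - 1))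
    (hZ : ∀ σ, ∃ P : ℤ[X], ∀ (K : Type) [Field K] [Finite K],
      (Nat.card {M : Matrix W W K // ((H.comap some).SymmAvoids M ∧ M.rank = σ) ∧ Z K M} : ℤ) =
        P.eval (Nat.card K : ℤ))
    (hcount : ∀ σ, ∃ P : ℤ[X], ∀ (K : Type) [Field K] [Finite K],
      ((H.comap some).symmRankCount K σ : ℤ) = P.eval (Nat.card K : ℤ)) (ρ : ℕ) :
    ∃ P : ℤ[X], ∀ (K : Type) [Field K] [Finite K],
      (H.symmRankCount K ρ : ℤ) = P.eval (Nat.card K : ℤ) := by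
  choose P hP using hZ
  choose Q hQ using hcount
  -- `P σ` counts the matrices of rank `σ` satisfying `Z`, and `Q σ - P σ` the others.
  refine ⟨∑ σ ∈ Finset.range (Fintype.card W + 1),
    (P σ * borderPolynomial ρ σ e (X ^ σ) +
      (Q σ - P σ) * borderPolynomial ρ σ e (X ^ (σ - 1))), fun K _ _ => ?_⟩
  rw [SimpleGraph.symmRankCount, Nat.card_congr (H.symmAvoidsEquiv K ρ)]
  have := Fintype.ofFinite {M : Matrix W W K // (H.comap some).SymmAvoids M}
  rw [Nat.card_sigma, Nat.cast_sum, eval_finsetSum]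
  have key : ∀ M : {M : Matrix W W K // (H.comap some).SymmAvoids M},
      (Nat.card {p : (W → K) × K // p.1 ∈ H.borderSpace K ∧ (M.1.border p.1 p.2).rank = ρ} : ℤ) =
      ∑ σ ∈ Finset.range (Fintype.card W + 1),
        ((if M.1.rank = σ ∧ Z K M.1 then 1 else 0) *
            (borderPolynomial ρ σ e (X ^ σ)).eval (Nat.card K : ℤ) +
          (if M.1.rank = σ ∧ ¬ Z K M.1 then 1 else 0) *
            (borderPolynomial ρ σ e (X ^ (σ - 1))).eval (Nat.card K : ℤ)) := by
    intro M
    have hle : M.1.rank ∈ Finset.range (Fintype.card W + 1) := by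
      have := M.1.rank_le_card_width
      simp; omega
    rw [Finset.sum_eq_single_of_mem _ hle (by
      intro σ _ hσ
      simp [hσ.symm])]
    rw [Matrix.card_border_rank M.2.1, hU, ha K M.1 M.2]
    by_cases hz : Z K M.1
    · simp [hz, borderPolynomial, apply_ite (eval (Nat.card K : ℤ))]
    · simp [hz, borderPolynomial, apply_ite (eval (Nat.card K : ℤ))]
  rw [Finset.sum_congr rfl fun M _ => key M, Finset.sum_comm]
  refine Finset.sum_congr rfl fun σ _ => ?_
  rw [Finset.sum_add_distrib, ← Finset.sum_mul, ← Finset.sum_mul, Finset.sum_boole,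
    Finset.sum_boole, eval_add, eval_mul, eval_mul, eval_sub, ← hP, ← hQ]
  have h1 : (Finset.univ.filter fun M : {M : Matrix W W K // (H.comap some).SymmAvoids M} =>
      M.1.rank = σ ∧ Z K M.1).card =
      Nat.card {M : Matrix W W K // ((H.comap some).SymmAvoids M ∧ M.rank = σ) ∧ Z K M} := by
    rw [← Fintype.card_subtype, ← Nat.card_eq_fintype_card]
    exact Nat.card_congr
      ((Equiv.subtypeSubtypeEquivSubtypeInter _ fun M : Matrix W W K => M.rank = σ ∧ Z K M).trans
        (Equiv.subtypeEquivRight fun M => by rw [and_assoc]))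
  have h2 : (Finset.univ.filter fun M : {M : Matrix W W K // (H.comap some).SymmAvoids M} =>
      M.1.rank = σ).card = (H.comap some).symmRankCount K σ := by
    rw [← Fintype.card_subtype, ← Nat.card_eq_fintype_card]
    exact Nat.card_congr
      (Equiv.subtypeSubtypeEquivSubtypeInter _ fun M : Matrix W W K => M.rank = σ)
  have h3 := Finset.card_filter_add_card_filter_not
    (s := Finset.univ.filter fun M : {M : Matrix W W K // (H.comap some).SymmAvoids M} =>
      M.1.rank = σ) fun M => Z K M.1
  rw [Finset.filter_filter, Finset.filter_filter, h1, h2] at h3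
  rw [h1, ← h3]
  push_cast
  ring

end Step

/-! ### Induction over forests -/

section Forest

open Polynomial

/-- A component containing an edge is a nontrivial tree and has a leaf; without edges any vertex
works. -/
theorem SimpleGraph.IsAcyclic.exists_forall_adj_eq {V : Type*} [Finite V] [Nonempty V]
    {H : SimpleGraph V} (hH : H.IsAcyclic) :
    ∃ v, ∀ a b, H.Adj v a → H.Adj v b → a = b := by
  classical
  have := Fintype.ofFinite V
  by_cases hE : ∃ a b, H.Adj a b
  · obtain ⟨a, b, hab⟩ := hE
    let c := H.connectedComponentMk a
    have hT := hH.isTree_connectedComponent c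
    have hb : H.connectedComponentMk b = c := SimpleGraph.ConnectedComponent.sound hab.symm.reachable
    have : Nontrivial c := ⟨⟨a, rfl⟩, ⟨b, hb⟩, fun h => hab.ne (congrArg Subtype.val h)⟩
    obtain ⟨v, hv⟩ := hT.exists_vert_degree_one_of_nontrivial
    obtain ⟨w, hw, huniq⟩ := SimpleGraph.degree_eq_one_iff_existsUnique_adj.mp hv
    have hmem : ∀ u, H.Adj v.1 u → ∃ h : u ∈ c, w = ⟨u, h⟩ := by
      intro u hu
      have h : u ∈ c := (SimpleGraph.ConnectedComponent.sound hu.symm.reachable).trans v.2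
      exact ⟨h, (huniq ⟨u, h⟩ hu).symm⟩
    refine ⟨v.1, fun x y hx hy => ?_⟩
    obtain ⟨h1, h2⟩ := hmem x hx
    obtain ⟨h3, h4⟩ := hmem y hy
    exact congrArg Subtype.val (h2.symm.trans h4)
  · push Not at hE
    exact ⟨Classical.arbitrary V, fun a b h => absurd h (hE _ _)⟩

/-- Symmetric matrices whose row `u` is zero amount to symmetric matrices on the other indices. -/
theorem SimpleGraph.card_symmAvoids_row_eq_zero {W : Type} [Fintype W] [DecidableEq W]
    (H : SimpleGraph W) (u : W) (K : Type) [Field K] (σ : ℕ) :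
    Nat.card {M : Matrix W W K // (H.SymmAvoids M ∧ M.rank = σ) ∧ ∀ j, M u j = 0} =
      (H.comap (Subtype.val : {w // w ≠ u} → W)).symmRankCount K σ := by
  let e : Option {w // w ≠ u} ≃ W := Equiv.optionSubtypeNe u
  have h0 := (H.comap e).symmAvoids_border_iff (K := K)
  have hcomap : ((H.comap e).comap some) = H.comap (Subtype.val : {w // w ≠ u} → W) := by
    ext a b; simp [e]
  rw [hcomap] at h0
  -- A zero border is the case `y = 0` of adjoining a combination of columns, so the rank is kept.
  have hrank : ∀ M : Matrix {w // w ≠ u} {w // w ≠ u} K, M.IsSymm →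
      (M.border 0 0).rank = M.rank := fun M hM => by
    simpa using Matrix.rank_border_mulVec hM 0
  have hiff : ∀ N : Matrix (Option {w // w ≠ u}) (Option {w // w ≠ u}) K,
      (H.comap e).SymmAvoids N ↔ H.SymmAvoids (Matrix.reindex e e N) := by
    intro N
    refine and_congr ⟨fun h => h.submatrix e.symm, fun h => by simpa using h.submatrix e⟩
      ⟨fun h i j hij => h _ _ (by simpa using hij), fun h i j hij => by
        simpa using h (e i) (e j) hij⟩
  have heu : e.symm u = none := by simp [e]
  have hback : ∀ N : Matrix W W K, N.IsSymm → (∀ j, N u j = 0) →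
      Matrix.reindex e e ((N.submatrix Subtype.val Subtype.val).border 0 0) = N := by
    intro N hN hz
    rw [← Equiv.eq_symm_apply]
    ext i j
    rcases i with _ | i <;> rcases j with _ | j <;> simp [e, hz]
    rw [← hN.apply, hz]
  symm
  refine Nat.card_congr
    { toFun := fun M => ⟨Matrix.reindex e e (M.1.border 0 0), ⟨(hiff _).mp
        ((h0 _ _ _).mpr ⟨M.2.1, Submodule.zero_mem _⟩), ?_⟩, ?_⟩
      invFun := fun N => ⟨N.1.submatrix Subtype.val Subtype.val,
        ⟨N.2.1.1.1.submatrix _, fun i j hij => N.2.1.1.2 _ _ hij⟩, ?_⟩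
      left_inv := ?_
      right_inv := ?_ }
  · rw [Matrix.rank_reindex, hrank _ M.2.1.1, M.2.2]
  · intro j
    rw [Matrix.reindex_apply, Matrix.submatrix_apply, heu]
    rcases e.symm j with _ | j <;> rfl
  · obtain ⟨N, ⟨⟨hN, -⟩, hr⟩, hz⟩ := N
    rw [← hrank _ (hN.submatrix _), ← hr, ← Matrix.rank_reindex e e, hback N hN hz]
  · intro M
    ext i j
    simp [e, i.2, j.2]
  · rintro ⟨N, ⟨⟨hN, -⟩, hr⟩, hz⟩
    exact Subtype.ext (hback N hN hz)

theorem Submodule.natCard_eq_pow_finrank {K V : Type*} [Field K] [Finite K] [AddCommGroup V]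
    [Module K V] [Finite V] (U : Submodule K V) : Nat.card U = Nat.card K ^ Module.finrank K U :=
  Module.natCard_eq_pow_finrank

/-- A nonzero functional on a subspace cuts out a subspace of codimension one. -/
theorem Submodule.finrank_ker_inf {K V : Type*} [Field K] [AddCommGroup V] [Module K V]
    [FiniteDimensional K V] (f : V →ₗ[K] K) (U : Submodule K V) {v : V} (hv : v ∈ U)
    (hfv : f v ≠ 0) :
    Module.finrank K ↥(LinearMap.ker f ⊓ U) = Module.finrank K U - 1 := by
  have h1 := LinearMap.finrank_range_add_finrank_ker (f.comp U.subtype)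
  rw [finrank_range_of_ne_zero (v := ⟨v, hv⟩) (by simpa using hfv)] at h1
  have h2 : (LinearMap.ker (f.comp U.subtype)).map U.subtype = LinearMap.ker f ⊓ U := by
    ext x; simp [and_comm]
  rw [← h2, Submodule.finrank_map_subtype_eq]
  omega

/-- The number of symmetric matrices of given rank that vanish at the edges of a forest is a
polynomial in the size of the field. -/
theorem SimpleGraph.IsAcyclic.exists_polynomial_symmRankCount (n : ℕ) :
    ∀ (V : Type) [Fintype V], Fintype.card V = n → ∀ (H : SimpleGraph V), H.IsAcyclic → ∀ ρ : ℕ,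
      ∃ P : ℤ[X], ∀ (K : Type) [Field K] [Finite K],
        (H.symmRankCount K ρ : ℤ) = P.eval (Nat.card K : ℤ) := by
  classical
  induction n using Nat.strong_induction_on with
  | _ n ih =>
  intro V _ hV H hH ρ
  rcases isEmpty_or_nonempty V with hemp | hne
  · refine ⟨if ρ = 0 then 1 else 0, fun K _ _ => ?_⟩
    have hr : ∀ M : Matrix V V K, M.rank = 0 := fun M => by
      have := M.rank_le_card_width
      rw [Fintype.card_eq_zero] at this
      omega
    have hs : ∀ M : Matrix V V K, H.SymmAvoids M := fun M =>
      ⟨Subsingleton.elim _ _, fun i => hemp.elim i⟩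
    rw [SimpleGraph.symmRankCount]
    simp only [hr, hs, true_and]
    by_cases h : ρ = 0
    · simp [h]
    · simp [h, Ne.symm h]
  · obtain ⟨v, hv⟩ := hH.exists_forall_adj_eq
    let e : Option {w // w ≠ v} ≃ V := Equiv.optionSubtypeNe v
    have hcardW : Fintype.card {w // w ≠ v} + 1 = n := by
      rw [← hV, ← Fintype.card_congr e, Fintype.card_option]
    suffices h : ∃ P : ℤ[X], ∀ (K : Type) [Field K] [Finite K],
        ((H.comap e).symmRankCount K ρ : ℤ) = P.eval (Nat.card K : ℤ) by
      simpa only [SimpleGraph.symmRankCount_comap] using h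
    have hH' : ((H.comap e).comap some).IsAcyclic := by
      have h1 : (H.comap e).IsAcyclic := hH.of_comap e.toEmbedding
      exact h1.of_comap ⟨some, Option.some_injective _⟩
    have hcount := ih _ (by omega) {w // w ≠ v} rfl _ hH'
    by_cases hleaf : ∃ u, (H.comap e).Adj none (some u)
    · obtain ⟨u, hu⟩ := hleaf
      have hadj : ∀ i, (H.comap e).Adj none (some i) → i = u := fun i hi =>
        Option.some_injective _ (e.injective (hv _ _ hi hu))
      have hU : ∀ (K : Type) [Field K], (H.comap e).borderSpace K =
          LinearMap.ker (LinearMap.proj u : ({w // w ≠ v} → K) →ₗ[K] K) := by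
        intro K _
        ext x
        refine ⟨fun h => h u hu, fun h i hi => ?_⟩
        rw [hadj i hi]
        exact h
      -- Leaf case: the border space is the hyperplane `x u = 0`. It contains the column space
      -- exactly when row `u` of `M` is zero, and otherwise cuts it in codimension one. Counting
      -- matrices with row `u` zero removes a second vertex, hence the strong induction.
      refine (H.comap e).exists_polynomial_symmRankCount_option
        (Fintype.card {w // w ≠ v} - 1) (fun K _ M => ∀ j, M u j = 0) ?_ ?_ ?_ hcount ρ
      · intro K _ _
        rw [Submodule.natCard_eq_pow_finrank, hU]
        have h1 := Submodule.finrank_ker_inf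
          (LinearMap.proj u : ({w // w ≠ v} → K) →ₗ[K] K) ⊤ (v := fun _ => 1) trivial (by simp)
        rw [inf_top_eq, finrank_top, Module.finrank_fintype_fun_eq_card] at h1
        rw [h1]
      · intro K _ _ M hM
        rw [Submodule.natCard_eq_pow_finrank, hU]
        congr 1
        split_ifs with hz
        · rw [inf_eq_right.mpr, Matrix.rank]
          rintro _ ⟨y, rfl⟩
          simp [Matrix.mulVec, dotProduct, hz]
        · push Not at hz
          obtain ⟨j, hj⟩ := hz
          exact Submodule.finrank_ker_inf _ _ ⟨Pi.single j 1, rfl⟩ (by simpa using hj)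
      · intro σ
        obtain ⟨P, hP⟩ := ih (Fintype.card {w : {w // w ≠ v} // w ≠ u}) (by
          have := Fintype.card_subtype_lt (p := fun w : {w // w ≠ v} => w ≠ u) (x := u) (by simp)
          omega) _ rfl _ (hH'.of_comap (Function.Embedding.subtype _)) σ
        refine ⟨P, fun K _ _ => ?_⟩
        rw [SimpleGraph.card_symmAvoids_row_eq_zero]
        exact hP K
    · push Not at hleaf
      have hU : ∀ (K : Type) [Field K], (H.comap e).borderSpace K = ⊤ := by
        intro K _
        exact eq_top_iff.mpr fun x _ i hi => absurd hi (hleaf i)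
      -- Isolated case: every border is allowed, so the whole column space always counts.
      refine (H.comap e).exists_polynomial_symmRankCount_option
        (Fintype.card {w // w ≠ v}) (fun K _ M => True) ?_ ?_ ?_ hcount ρ
      · intro K _ _
        rw [Submodule.natCard_eq_pow_finrank, hU, finrank_top, Module.finrank_fintype_fun_eq_card]
      · intro K _ _ M hM
        rw [Submodule.natCard_eq_pow_finrank, hU, top_inf_eq, if_pos trivial, Matrix.rank]
      · intro σ
        simpa [SimpleGraph.symmRankCount] using hcount σ

end Forest

/-! ### The weighted matrix-tree theorem -/

section MatrixTree

variable {V : Type} (r : V)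

/-- The Laplacian of the weights `w`, without the row and the column of `r`. -/
def reducedLaplacian [Fintype V] [DecidableEq V] {K : Type*} [CommRing K] (w : Sym2 V → K) :
    Matrix {i // i ≠ r} {i // i ≠ r} K :=
  Matrix.of fun i j => ∑ v, w s(i.1, v) * ((if i = j then 1 else 0) - if v = j.1 then 1 else 0)

variable {r}

/-- The iterates of the parent function `f` end at the root: there is a height function. -/
def IsRootedParent (f : {i // i ≠ r} → V) : Prop :=
  ∃ d : V → ℕ, ∀ i, d (f i) < d i.1

theorem IsRootedParent.ne {f : {i // i ≠ r} → V} (hf : IsRootedParent f) (i : {i // i ≠ r}) :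
    f i ≠ i.1 := by
  obtain ⟨d, hd⟩ := hf
  intro h
  have := hd i
  rw [h] at this
  omega

/-- Two distinct vertices with the same parent edge would be each other's parents, which the height
forbids. -/
theorem IsRootedParent.edge_injective {f : {i // i ≠ r} → V} (hf : IsRootedParent f) :
    Function.Injective fun i : {i // i ≠ r} => s(i.1, f i) := by
  obtain ⟨d, hd⟩ := hf
  intro i j hij
  rcases Sym2.eq_iff.mp hij with ⟨h, -⟩ | ⟨h1, h2⟩
  · exact Subtype.ext h
  · have hi := hd i
    have hj := hd j
    rw [h2] at hi
    rw [← h1] at hj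
    omega

/-- The graph with an edge from each vertex other than the root to its parent. -/
def parentGraph (f : {i // i ≠ r} → V) : SimpleGraph V :=
  SimpleGraph.fromEdgeSet (Set.range fun i => s(i.1, f i))

theorem IsRootedParent.edgeSet_parentGraph {f : {i // i ≠ r} → V} (hf : IsRootedParent f) :
    (parentGraph f).edgeSet = Set.range fun i => s(i.1, f i) := by
  rw [parentGraph, SimpleGraph.edgeSet_fromEdgeSet, sdiff_eq_left, Set.disjoint_left]
  rintro _ ⟨i, rfl⟩ h
  exact hf.ne i (by simpa using h.symm)

theorem IsRootedParent.adj_parent {f : {i // i ≠ r} → V} (hf : IsRootedParent f)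
    (i : {i // i ≠ r}) : (parentGraph f).Adj i.1 (f i) := by
  rw [← SimpleGraph.mem_edgeSet, hf.edgeSet_parentGraph]
  exact ⟨i, rfl⟩

theorem IsRootedParent.connected_parentGraph {f : {i // i ≠ r} → V} (hf : IsRootedParent f) :
    (parentGraph f).Connected := by
  have hadj := hf.adj_parent
  obtain ⟨d, hd⟩ := hf
  have hreach : ∀ n v, d v = n → (parentGraph f).Reachable v r := by
    intro n
    induction n using Nat.strong_induction_on with
    | _ n ih =>
    intro v hv
    by_cases h : v = r
    · rw [h]
    · exact (hadj ⟨v, h⟩).reachable.trans (ih _ (hv ▸ hd ⟨v, h⟩) _ rfl)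
  have : Nonempty V := ⟨r⟩
  exact ⟨fun u v => (hreach _ u rfl).trans (hreach _ v rfl).symm⟩

/-- Induction on the height for `f`. The edge from `i` to `f i` is the `g`-edge of some `j`. Either
`j = i` and the parents agree, or `j = f i` is lower with `g j = i`; then `f j = i` by induction,
and the heights contradict each other. -/
theorem IsRootedParent.eq_of_parentGraph_eq {f g : {i // i ≠ r} → V}
    (hf : IsRootedParent f) (hg : IsRootedParent g)
    (h : parentGraph f = parentGraph g) : f = g := by
  have hadj := hf.adj_parent
  obtain ⟨d, hd⟩ := hf
  have key : ∀ n (i : {i // i ≠ r}), d i.1 = n → f i = g i := by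
    intro n
    induction n using Nat.strong_induction_on with
    | _ n ih =>
    intro i hi
    have h1 := hadj i
    rw [h, ← SimpleGraph.mem_edgeSet, hg.edgeSet_parentGraph] at h1
    obtain ⟨j, hj⟩ := h1
    rcases Sym2.eq_iff.mp hj with ⟨h1, h2⟩ | ⟨h1, h2⟩
    · rw [← h2, Subtype.ext h1]
    · have h3 : d j.1 < d i.1 := by rw [h1]; exact hd i
      have h4 := ih _ (hi ▸ h3) j rfl
      have h5 := hd j
      rw [h4, h2] at h5
      omega
  exact funext fun i => key _ i rfl

/-- The parent is the next vertex on a shortest path to the root, with the distance as height. The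
resulting graph is connected and inside `T`, hence equal to it, as a tree is minimally connected. -/
theorem SimpleGraph.IsTree.exists_parentGraph_eq {T : SimpleGraph V} (hT : T.IsTree) :
    ∃ f : {i // i ≠ r} → V, IsRootedParent f ∧ parentGraph f = T := by
  have hstep : ∀ i : {i // i ≠ r}, ∃ u, T.Adj i.1 u ∧ T.dist u r < T.dist i.1 r := by
    rintro ⟨i, hi⟩
    change ∃ u, T.Adj i u ∧ T.dist u r < T.dist i r
    obtain ⟨p, hp⟩ := hT.connected.exists_walk_length_eq_dist i r
    cases p with
    | nil => exact absurd rfl hi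
    | cons h q =>
      refine ⟨_, h, ?_⟩
      rw [← hp, SimpleGraph.Walk.length_cons]
      exact Nat.lt_succ_of_le (SimpleGraph.dist_le q)
  choose f hf1 hf2 using hstep
  have hf : IsRootedParent f := ⟨fun v => T.dist v r, hf2⟩
  refine ⟨f, hf, le_antisymm ?_ ?_⟩
  · rw [← SimpleGraph.edgeSet_subset_edgeSet, hf.edgeSet_parentGraph]
    rintro _ ⟨i, rfl⟩
    exact hf1 i
  · refine (SimpleGraph.isTree_iff_minimal_connected.mp hT).2 hf.connected_parentGraph ?_
    rw [← SimpleGraph.edgeSet_subset_edgeSet, hf.edgeSet_parentGraph]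
    rintro _ ⟨i, rfl⟩
    exact hf1 i

/-- The matrix `1 - A` with `A` the transition matrix of `f`. -/
def parentMatrix [DecidableEq V] (K : Type*) [CommRing K] (f : {i // i ≠ r} → V) :
    Matrix {i // i ≠ r} {i // i ≠ r} K :=
  Matrix.of fun i j => (if i = j then 1 else 0) - if f i = j.1 then 1 else 0

variable [Fintype V] [DecidableEq V]

/-- Row `i` is the sum over `v` of `w s(i, v)` times the difference of the unit vectors of `i` and
`v`, that of the root being zero; expand multilinearly in the rows. -/
theorem det_reducedLaplacian_eq_sum_functions {K : Type*} [CommRing K] (w : Sym2 V → K) :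
    (reducedLaplacian r w).det =
      ∑ f : {i // i ≠ r} → V, (∏ i, w s(i.1, f i)) * (parentMatrix K f).det := by
  have h1 : reducedLaplacian r w = fun i => ∑ v, w s(i.1, v) •
      fun j : {i // i ≠ r} => ((if i = j then 1 else 0) - if v = j.1 then 1 else 0 : K) := by
    ext i j
    simp [reducedLaplacian]
  rw [h1]
  change Matrix.detRowAlternating.toMultilinearMap _ = _
  rw [MultilinearMap.map_sum]
  refine Finset.sum_congr rfl fun f _ => ?_
  rw [MultilinearMap.map_smul_univ, smul_eq_mul]
  rfl

/-- Ordered by height, the matrix is block triangular with identity diagonal blocks. -/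
theorem IsRootedParent.det_parentMatrix {K : Type*} [CommRing K] {f : {i // i ≠ r} → V}
    (hf : IsRootedParent f) : (parentMatrix K f).det = 1 := by
  obtain ⟨d, hd⟩ := hf
  have hbt : (parentMatrix K f).BlockTriangular fun i => OrderDual.toDual (d i.1) := by
    intro i j hij
    have hij' : d i.1 < d j.1 := hij
    have h1 : i ≠ j := by rintro rfl; omega
    have h2 : f i ≠ j.1 := by
      intro h
      have := hd i
      rw [h] at this
      omega
    simp [parentMatrix, h1, h2]
  rw [hbt.det]
  refine Finset.prod_eq_one fun a _ => ?_
  suffices h : (parentMatrix K f).toSquareBlock (fun i => OrderDual.toDual (d i.1)) a = 1 by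
    rw [h, Matrix.det_one]
  ext ⟨i, hi⟩ ⟨j, hj⟩
  have h2 : f i ≠ j.1 := by
    intro h
    have h3 := hd i
    rw [h] at h3
    have h4 : OrderDual.toDual (d i.1) = OrderDual.toDual (d j.1) := hi.trans hj.symm
    have h5 : d i.1 = d j.1 := h4
    omega
  simp [Matrix.toSquareBlock, Matrix.toSquareBlockProp, parentMatrix, h2, Matrix.one_apply]

/-- The indicator of the vertices whose iterates never reach the root is a nonzero kernel vector. -/
theorem det_parentMatrix_eq_zero {K : Type*} [Field K] {f : {i // i ≠ r} → V}
    (hf : ¬ IsRootedParent f) : (parentMatrix K f).det = 0 := by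
  classical
  let g : V → V := fun i => if h : i ≠ r then f ⟨i, h⟩ else r
  have hg : ∀ i : {i // i ≠ r}, g i.1 = f i := fun i => by simp [g, i.2]
  by_cases hall : ∀ i, ∃ k, g^[k] i = r
  · refine absurd ⟨fun i => Nat.find (hall i), fun i => ?_⟩ hf
    have h1 := Nat.find_spec (hall i.1)
    change Nat.find (hall (f i)) < Nat.find (hall i.1)
    rcases hk : Nat.find (hall i.1) with _ | k
    · rw [hk] at h1
      exact absurd h1 i.2
    · rw [hk, Function.iterate_succ_apply, hg] at h1
      exact Nat.lt_succ_of_le (Nat.find_min' (hall (f i)) h1)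
  · push Not at hall
    obtain ⟨i₀, hi₀⟩ := hall
    have hi₀r : i₀ ≠ r := hi₀ 0
    refine Matrix.exists_mulVec_eq_zero_iff.mp
      ⟨fun i => if ∀ k, g^[k] i.1 ≠ r then 1 else 0, fun h => ?_, ?_⟩
    · have := congrFun h ⟨i₀, hi₀r⟩
      simp [hi₀] at this
    · ext i
      have hstep : (∀ k, g^[k] i.1 ≠ r) ↔ ∀ k, g^[k] (f i) ≠ r := by
        rw [← hg]
        constructor
        · intro h k
          exact h (k + 1)
        · intro h k
          rcases k with _ | k
          · exact i.2
          · exact h k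
      simp only [Matrix.mulVec, dotProduct, parentMatrix, Matrix.of_apply, sub_mul,
        Finset.sum_sub_distrib, ite_mul, one_mul, zero_mul, Finset.sum_ite_eq, Finset.mem_univ,
        if_true, Pi.zero_apply]
      by_cases hfi : f i = r
      · rw [if_neg (fun h => hstep.mp h 0 hfi), Finset.sum_eq_zero, sub_zero]
        intro j _
        rw [if_neg fun h => j.2 (h.symm.trans hfi)]
      · rw [Finset.sum_eq_single_of_mem ⟨f i, hfi⟩ (Finset.mem_univ _)]
        · simp only [if_true, hstep, sub_self]
        · intro j _ hj
          rw [if_neg fun h => hj (Subtype.ext h.symm)]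

theorem IsRootedParent.isTree_parentGraph {f : {i // i ≠ r} → V}
    (hf : IsRootedParent f) : (parentGraph f).IsTree := by
  rw [SimpleGraph.isTree_iff_connected_and_card]
  refine ⟨hf.connected_parentGraph, ?_⟩
  rw [hf.edgeSet_parentGraph, Nat.card_range_of_injective hf.edge_injective,
    ← Nat.card_congr (Equiv.optionSubtypeNe r), Finite.card_option]

open Classical in
/-- The weighted matrix-tree theorem. -/
theorem det_reducedLaplacian_eq_sum_trees {K : Type*} [Field K] (w : Sym2 V → K) :
    (reducedLaplacian r w).det =
      ∑ T : SimpleGraph V with T.IsTree, ∏ e ∈ T.edgeSet.toFinset, w e := by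
  rw [det_reducedLaplacian_eq_sum_functions,
    ← Finset.sum_filter_of_ne (p := IsRootedParent) (fun f _ h => by
      by_contra hf
      exact h (by rw [det_parentMatrix_eq_zero hf, mul_zero]))]
  refine Finset.sum_nbij parentGraph ?_ ?_ ?_ ?_
  · intro f hf
    exact Finset.mem_filter.mpr
      ⟨Finset.mem_univ _, (Finset.mem_filter.mp hf).2.isTree_parentGraph⟩
  · intro f hf g hg h
    exact (Finset.mem_filter.mp hf).2.eq_of_parentGraph_eq (Finset.mem_filter.mp hg).2 h
  · intro T hT
    obtain ⟨f, hf, rfl⟩ := (Finset.mem_filter.mp hT).2.exists_parentGraph_eq (r := r)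
    exact ⟨f, by simpa using hf, rfl⟩
  · intro f hf
    have hf' := (Finset.mem_filter.mp hf).2
    rw [hf'.det_parentMatrix, mul_one]
    have : (parentGraph f).edgeSet.toFinset = Finset.univ.image fun i => s(i.1, f i) := by
      ext e
      simp [hf'.edgeSet_parentGraph]
    rw [this, Finset.prod_image fun i _ j _ h => hf'.edge_injective h]

end MatrixTree

/-! ### Field-valued points of the two schemes -/

section Points

/-- The points of the spectrum of a localization away from `a` with values in a field. -/
noncomputable def specAwayPointsEquiv {R : Type} [CommRing R] (a : R) (K : Type) [Field K] :
    (Spec (CommRingCat.of K) ⟶ Spec (CommRingCat.of (Localization.Away a))) ≃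
      {φ : R →+* K // φ a ≠ 0} :=
  (Spec.homEquiv.trans
    { toFun := fun φ => φ.hom
      invFun := fun φ => CommRingCat.ofHom φ
      left_inv := fun _ => rfl
      right_inv := fun _ => rfl }).trans
    { toFun := fun φ => ⟨φ.comp (algebraMap R (Localization.Away a)),
        ((IsLocalization.Away.algebraMap_isUnit a).map φ).ne_zero⟩
      invFun := fun φ => IsLocalization.Away.lift a (g := φ.1) φ.2.isUnit
      left_inv := fun _ => IsLocalization.ringHom_ext (Submonoid.powers a)
        (IsLocalization.Away.lift_comp a _)
      right_inv := fun _ => Subtype.ext (IsLocalization.Away.lift_comp a _) }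

theorem Matrix.det_ne_zero_iff_rank {V K : Type*} [Fintype V] [DecidableEq V] [Field K]
    (M : Matrix V V K) : M.det ≠ 0 ↔ M.rank = Fintype.card V := by
  refine ⟨Matrix.rank_of_det_ne_zero, fun h hdet => ?_⟩
  obtain ⟨v, hv, hMv⟩ := Matrix.exists_mulVec_eq_zero_iff.mpr hdet
  have h1 := M.rank_add_finrank_ker
  have h2 : Module.finrank K (LinearMap.ker M.mulVecLin) = 0 := by omega
  rw [Submodule.finrank_eq_zero] at h2
  have h3 : v ∈ LinearMap.ker M.mulVecLin := hMv
  rw [h2] at h3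
  exact hv h3

variable {V : Type} [Fintype V] [DecidableEq V]

/-- The points of `Z^o_G` over a field are the nondegenerate symmetric matrices that vanish at the
non-edges of `G`. -/
noncomputable def nondegSymmetricPointsEquiv (G : SimpleGraph V) (K : Type) [Field K] :
    (Spec (CommRingCat.of K) ⟶ nondegSymmetricScheme G) ≃
      {M : Matrix V V K // Gᶜ.SymmAvoids M ∧ M.rank = Fintype.card V} :=
  (specAwayPointsEquiv (genericSymmetricMatrix G).det K).trans
    { toFun := fun φ => ⟨φ.1.mapMatrix (genericSymmetricMatrix G), by
        refine ⟨⟨?_, fun i j hij => ?_⟩, ?_⟩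
        · ext i j
          refine congrArg φ.1 (Ideal.Quotient.eq.mpr (Ideal.subset_span (Or.inl ⟨j, i, rfl⟩)))
        · rw [SimpleGraph.compl_adj] at hij
          have h : Ideal.Quotient.mk (symmetricSupportIdeal G) (MvPolynomial.X (i, j)) = 0 :=
            Ideal.Quotient.eq_zero_iff_mem.mpr
              (Ideal.subset_span (Or.inr ⟨i, j, hij.1, hij.2, rfl⟩))
          exact (congrArg φ.1 h).trans (map_zero _)
        · rw [← Matrix.det_ne_zero_iff_rank, ← RingHom.map_det]
          exact φ.2⟩
      invFun := fun M => ⟨Ideal.Quotient.lift (symmetricSupportIdeal G)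
          (MvPolynomial.eval₂Hom (Int.castRingHom K) fun p => M.1 p.1 p.2) (by
            intro a ha
            rw [← RingHom.mem_ker]
            revert a
            change symmetricSupportIdeal G ≤ _
            rw [symmetricSupportIdeal, Ideal.span_le]
            rintro _ (⟨i, j, rfl⟩ | ⟨i, j, hij, hG, rfl⟩)
            · simp [RingHom.mem_ker, M.2.1.1.apply i j]
            · simp [RingHom.mem_ker, M.2.1.2 i j ⟨hij, hG⟩]), by
          rw [RingHom.map_det]
          convert (Matrix.det_ne_zero_iff_rank M.1).mpr M.2.2
          ext i j
          simp [genericSymmetricMatrix]⟩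
      left_inv := fun φ => Subtype.ext (Ideal.Quotient.ringHom_ext (MvPolynomial.ringHom_ext
        (fun n => by simp) (fun p => by simp [genericSymmetricMatrix])))
      right_inv := fun M => Subtype.ext (by
        ext i j
        simp [genericSymmetricMatrix]) }

/-- The points of `X_G` over a field. -/
noncomputable def stanleyPointsEquiv (G : SimpleGraph V) (K : Type) [Field K] :
    (Spec (CommRingCat.of K) ⟶ stanleyScheme G) ≃
      {x : G.edgeSet → K //
        MvPolynomial.eval₂Hom (Int.castRingHom K) x (stanleyPolynomial G) ≠ 0} :=
  (specAwayPointsEquiv (stanleyPolynomial G) K).trans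
    { toFun := fun φ => ⟨fun e => φ.1 (MvPolynomial.X e), by
        convert φ.2 using 2
        exact MvPolynomial.ringHom_ext (fun n => by simp) fun p => by simp⟩
      invFun := fun x => ⟨MvPolynomial.eval₂Hom (Int.castRingHom K) x.1, x.2⟩
      left_inv := fun φ => Subtype.ext (MvPolynomial.ringHom_ext (fun n => by simp)
          fun p => by simp)
      right_inv := fun x => Subtype.ext (by ext e; simp) }

end Points

/-! ### Edge weights as symmetric matrices -/

section StanleyCount

variable {V : Type} [Fintype V] [DecidableEq V]

open Classical in
/-- The weights on all pairs of vertices that are zero outside the edges of `G`. -/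
noncomputable def extendWeights {K : Type*} [Zero K] (G : SimpleGraph V) (x : G.edgeSet → K) :
    Sym2 V → K :=
  fun e => if h : e ∈ G.edgeSet then x ⟨e, h⟩ else 0

/-- Extending the weights by zero kills every tree not contained in `G`. -/
theorem eval_stanleyPolynomial {K : Type*} [Field K] (G : SimpleGraph V) (r : V)
    (x : G.edgeSet → K) :
    MvPolynomial.eval₂Hom (Int.castRingHom K) x (stanleyPolynomial G) =
      (reducedLaplacian r (extendWeights G x)).det := by
  classical
  rw [det_reducedLaplacian_eq_sum_trees, stanleyPolynomial, map_sum]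
  simp only [map_prod, MvPolynomial.coe_eval₂Hom, MvPolynomial.eval₂_X]
  refine Finset.sum_subset_zero_on_sdiff ?_ ?_ ?_ <;> intro T hT
  · simp only [Finset.mem_filter, Finset.mem_univ, true_and] at hT ⊢
    exact hT.2
  · simp only [Finset.mem_sdiff, Finset.mem_filter, Finset.mem_univ, true_and, not_and] at hT
    have hTG : ¬ T ≤ G := fun h => hT.2 h hT.1
    rw [← SimpleGraph.edgeSet_subset_edgeSet, Set.not_subset] at hTG
    obtain ⟨e, he, heG⟩ := hTG
    exact Finset.prod_eq_zero (Set.mem_toFinset.mpr he) (by simp [extendWeights, heG])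
  · simp only [Finset.mem_filter, Finset.mem_univ, true_and] at hT
    refine Finset.prod_nbij Subtype.val ?_ ?_ ?_ ?_
    · intro e he
      simpa using he
    · exact Subtype.val_injective.injOn
    · intro e he
      have he' : e ∈ T.edgeSet := by simpa using he
      exact ⟨⟨e, SimpleGraph.edgeSet_subset_edgeSet.mpr hT.1 he'⟩, by simpa using he', rfl⟩
    · intro e _
      simp [extendWeights]

variable {r : V} {K : Type*} [Field K]

theorem reducedLaplacian_apply_of_ne (w : Sym2 V → K) {i j : {i // i ≠ r}} (h : i ≠ j) :
    reducedLaplacian r w i j = -w s(i.1, j.1) := by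
  simp [reducedLaplacian, h]

/-- The contribution of each `v` other than the root cancels along the row; the root's does not,
since its column is removed. -/
theorem sum_reducedLaplacian (w : Sym2 V → K) (i : {i // i ≠ r}) :
    ∑ j, reducedLaplacian r w i j = w s(i.1, r) := by
  simp only [reducedLaplacian, Matrix.of_apply]
  rw [Finset.sum_comm, Finset.sum_eq_single_of_mem r (Finset.mem_univ _)]
  · rw [← Finset.mul_sum, Finset.sum_sub_distrib, Finset.sum_eq_zero (s := Finset.univ)
      (f := fun j : {i // i ≠ r} => if r = j.1 then (1 : K) else 0)]
    · simp
    · intro j _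
      rw [if_neg fun h => j.2 h.symm]
  · intro v _ hv
    rw [← Finset.mul_sum, Finset.sum_sub_distrib]
    have : ∀ j : {i // i ≠ r}, v = j.1 ↔ ⟨v, hv⟩ = j := fun j =>
      ⟨fun h => Subtype.ext h, fun h => congrArg Subtype.val h⟩
    simp [this]

theorem Matrix.ext_of_sum_eq {W : Type*} [Fintype W] {A B : Matrix W W K}
    (hoff : ∀ i j, i ≠ j → A i j = B i j) (hsum : ∀ i, ∑ j, A i j = ∑ j, B i j) : A = B := by
  classical
  ext i j
  by_cases h : i = j
  · subst h
    have h1 := hsum i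
    rw [← Finset.add_sum_erase _ _ (Finset.mem_univ i),
      ← Finset.add_sum_erase Finset.univ (fun j => B i j) (Finset.mem_univ i),
      Finset.sum_congr rfl fun j hj => hoff i j (Finset.ne_of_mem_erase hj).symm] at h1
    exact add_right_cancel h1
  · exact hoff i j h

/-- If `r` is adjacent to all other vertices, the reduced Laplacian identifies edge weights with
symmetric matrices. -/
theorem exists_equiv_reducedLaplacian (G : SimpleGraph V) (hr : ∀ v, v ≠ r → G.Adj v r) :
    ∃ e : (G.edgeSet → K) ≃ {M : Matrix {i // i ≠ r} {i // i ≠ r} K //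
        (Gᶜ.comap Subtype.val).SymmAvoids M},
      ∀ x, (e x).1 = reducedLaplacian r (extendWeights G x) := by
  classical
  have hmem : ∀ x : G.edgeSet → K,
      (Gᶜ.comap (Subtype.val : {i // i ≠ r} → V)).SymmAvoids
        (reducedLaplacian r (extendWeights G x)) := by
    intro x
    refine ⟨?_, ?_⟩
    · ext i j
      by_cases h : i = j
      · rw [h]; rfl
      · rw [Matrix.transpose_apply, reducedLaplacian_apply_of_ne _ h,
          reducedLaplacian_apply_of_ne _ (Ne.symm h), Sym2.eq_swap]
    · intro i j hij
      have hij' : i.1 ≠ j.1 ∧ ¬ G.Adj i.1 j.1 := hij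
      rw [reducedLaplacian_apply_of_ne _ fun h => hij'.1 (congrArg _ h)]
      simp [extendWeights, hij'.2]
  refine ⟨Equiv.ofBijective (fun x => ⟨_, hmem x⟩) ⟨fun x y hxy => ?_, fun M => ?_⟩, fun x => rfl⟩
  -- Row sums recover the weights at the root, off-diagonal entries the others.
  · have h : reducedLaplacian r (extendWeights G x) = reducedLaplacian r (extendWeights G y) :=
      congrArg Subtype.val hxy
    have hroot : ∀ i, i ≠ r → extendWeights G x s(i, r) = extendWeights G y s(i, r) := by
      intro i hi
      exact (sum_reducedLaplacian (extendWeights G x) ⟨i, hi⟩).symm.trans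
        (h ▸ sum_reducedLaplacian (extendWeights G y) ⟨i, hi⟩)
    have hext : ∀ i j, G.Adj i j → extendWeights G x s(i, j) = extendWeights G y s(i, j) := by
      intro i j hij
      by_cases hi : i = r
      · subst hi
        rw [Sym2.eq_swap]
        exact hroot j hij.ne'
      · by_cases hj : j = r
        · subst hj
          exact hroot i hi
        · have hne : (⟨i, hi⟩ : {i // i ≠ r}) ≠ ⟨j, hj⟩ := fun h => hij.ne (congrArg Subtype.val h)
          have h1 := congrFun (congrFun h ⟨i, hi⟩) ⟨j, hj⟩
          rw [reducedLaplacian_apply_of_ne _ hne, reducedLaplacian_apply_of_ne _ hne] at h1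
          exact neg_injective h1
    ext ⟨e, he⟩
    induction e with
    | _ i j =>
      have h2 := hext i j he
      rw [extendWeights, extendWeights, dif_pos he, dif_pos he] at h2
      exact h2
  · obtain ⟨M, hM⟩ := M
    -- The inverse: row sums as weights at the root, negated entries elsewhere. The values at `(r,
    -- r)` and on the diagonal are irrelevant, as loops are not edges.
    let w : V → V → K := fun i j =>
      if hi : i = r then if hj : j = r then 0 else ∑ k, M ⟨j, hj⟩ k
      else if hj : j = r then ∑ k, M ⟨i, hi⟩ k else -M ⟨i, hi⟩ ⟨j, hj⟩
    have hw : ∀ i j, w i j = w j i := by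
      intro i j
      by_cases hi : i = r <;> by_cases hj : j = r <;> simp [w, hi, hj]
      exact hM.1.apply _ _
    refine ⟨fun e => Sym2.lift ⟨w, hw⟩ e.1, Subtype.ext ?_⟩
    refine Matrix.ext_of_sum_eq (fun i j hij => ?_) fun i => ?_
    · change reducedLaplacian r _ i j = _
      rw [reducedLaplacian_apply_of_ne _ hij]
      by_cases hG : G.Adj i.1 j.1
      · simp [extendWeights, hG, w, i.2, j.2]
      · have h0 : M i j = 0 := hM.2 i j ⟨fun h => hij (Subtype.ext h), hG⟩
        simp [extendWeights, hG, h0]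
    · change ∑ j, reducedLaplacian r _ i j = _
      rw [sum_reducedLaplacian]
      simp [extendWeights, hr i.1 i.2, w, i.2]

end StanleyCount

/-! ### Conclusion for both schemes -/

theorem polynomiallyCountable_nondegSymmetricScheme {V : Type} [Fintype V] [DecidableEq V]
    (G : SimpleGraph V) (hG : Gᶜ.IsAcyclic) : PolynomiallyCountable (nondegSymmetricScheme G) := by
  obtain ⟨P, hP⟩ := SimpleGraph.IsAcyclic.exists_polynomial_symmRankCount _ V rfl Gᶜ hG
    (Fintype.card V)
  refine ⟨P, fun K _ _ => ⟨Finite.of_equiv _ (nondegSymmetricPointsEquiv G K).symm, ?_⟩⟩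
  rw [← hP, SimpleGraph.symmRankCount, Nat.card_congr (nondegSymmetricPointsEquiv G K)]

theorem polynomiallyCountable_stanleyScheme {V : Type} [Fintype V] [DecidableEq V]
    (G : SimpleGraph V) (hG : Gᶜ.IsAcyclic) {r : V} (hr : ∀ v, v ≠ r → G.Adj v r) :
    PolynomiallyCountable (stanleyScheme G) := by
  obtain ⟨P, hP⟩ := SimpleGraph.IsAcyclic.exists_polynomial_symmRankCount _ {i // i ≠ r} rfl
    (Gᶜ.comap Subtype.val) (hG.of_comap (Function.Embedding.subtype _))
    (Fintype.card {i // i ≠ r})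
  refine ⟨P, fun K _ _ => ⟨Finite.of_equiv _ (stanleyPointsEquiv G K).symm, ?_⟩⟩
  obtain ⟨e, he⟩ := exists_equiv_reducedLaplacian (K := K) G hr
  rw [← hP, SimpleGraph.symmRankCount, Nat.card_congr (stanleyPointsEquiv G K)]
  congr 1
  refine Nat.card_congr ((e.subtypeEquiv fun x => ?_).trans
    (Equiv.subtypeSubtypeEquivSubtypeInter _
      fun M : Matrix {i // i ≠ r} {i // i ≠ r} K => M.rank = Fintype.card {i // i ≠ r}))
  rw [he, ← Matrix.det_ne_zero_iff_rank, eval_stanleyPolynomial G r]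

/-- Every vertex of a cycle lies on an edge of `F`, so the cycle already lives on `F.verts`; the
added vertices are isolated. -/
theorem SimpleGraph.Subgraph.isAcyclic_spanningCoe {V : Type*} {G : SimpleGraph V}
    {F : G.Subgraph} (hF : F.coe.IsAcyclic) : F.spanningCoe.IsAcyclic := by
  intro v c hc
  have hsupp : ∀ u ∈ c.support, u ∈ F.verts := by
    intro u hu
    obtain ⟨e, he, hue⟩ :=
      (SimpleGraph.Walk.mem_support_iff_exists_mem_edges_of_not_nil hc.not_nil).mp hu
    have he' := c.edges_subset_edgeSet he
    rw [SimpleGraph.Subgraph.edgeSet_spanningCoe] at he'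
    exact SimpleGraph.Subgraph.mem_verts_of_mem_edge he' hue
  have hind : (F.spanningCoe.induce F.verts) = F.coe := by
    ext a b
    rfl
  rw [← hind] at hF
  refine hF (c.induce F.verts hsupp) ?_
  rw [← SimpleGraph.Walk.isCycle_map_iff_of_injective
    (f := (SimpleGraph.Embedding.induce (G := F.spanningCoe) F.verts).toHom)
    (SimpleGraph.Embedding.induce (G := F.spanningCoe) F.verts).injective]
  exact (SimpleGraph.Walk.map_induce c hsupp).symm ▸ hc

theorem mainTheorem9 (s r : ℕ) (F : (⊤ : SimpleGraph (Fin s)).Subgraph)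
    (hF : F.coe.IsAcyclic) (hr : F.verts.ncard = r) :
    PolynomiallyCountable
        (nondegSymmetricScheme ((⊤ : SimpleGraph (Fin s)).deleteEdges F.edgeSet)) ∧
      (s > r →
        PolynomiallyCountable
          (stanleyScheme ((⊤ : SimpleGraph (Fin s)).deleteEdges F.edgeSet))) := by
  have hcompl : ((⊤ : SimpleGraph (Fin s)).deleteEdges F.edgeSet)ᶜ = F.spanningCoe := by
    ext i j
    simp only [SimpleGraph.compl_adj, SimpleGraph.deleteEdges_adj, SimpleGraph.top_adj,
      SimpleGraph.Subgraph.mem_edgeSet, SimpleGraph.Subgraph.spanningCoe_adj]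
    refine ⟨fun h => not_not.mp fun h' => h.2 ⟨h.1, h'⟩, fun h => ⟨h.ne, fun h' => h'.2 h⟩⟩
  have hac : ((⊤ : SimpleGraph (Fin s)).deleteEdges F.edgeSet)ᶜ.IsAcyclic := by
    rw [hcompl]
    exact SimpleGraph.Subgraph.isAcyclic_spanningCoe hF
  refine ⟨polynomiallyCountable_nondegSymmetricScheme _ hac, fun hsr => ?_⟩
  -- Since `s > r`, some vertex is outside `F`; no edge at it is removed, so it can serve as the
  -- root.
  obtain ⟨v, hv⟩ : ∃ v, v ∉ F.verts := by
    by_contra! h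
    have h1 : F.verts = Set.univ := Set.eq_univ_of_forall h
    rw [h1, Set.ncard_univ, Nat.card_fin] at hr
    omega
  refine polynomiallyCountable_stanleyScheme _ hac (r := v) fun u hu => ?_
  simp only [SimpleGraph.deleteEdges_adj, SimpleGraph.top_adj, SimpleGraph.Subgraph.mem_edgeSet]
  exact ⟨hu, fun h => hv h.snd_mem⟩
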